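/- Let $\mathcal X$ be a finite set and let $W=(W(x|\bar x))_{x,\bar x\in\mathcal X}$ be a transition matrix ($W(x|\bar x)\ge 0$, $\sum_x W(x|\bar x)=1$) that is ergodic, i.e. irreducible and aperiodic (for no state $\bar x$ and no integer $d\ge 2$ is every $n$ with $W^n(\bar x|\bar x)>0$ divisible by $d$). Let $P$ be an arbitrary probability distribution on $\mathcal X$, let $g:\mathcal X\times\mathcal X\to\mathbb R$ and $h:\mathcal X\to\mathbb R$ be arbitrary functions, and let $X_1,X_2,\dots$ be the Markov chain with initial distribution $P$ and transition matrix $W$, so that $\Pr(X_1=x_1,\dots,X_{n+1}=x_{n+1})=P(x_1)\prod_{i=1}^n W(x_{i+1}|x_i)$. Put $$\tilde g^n:=\sum_{i=1}^n g(X_{i+1},X_i)+h(X_1).$$ Let $\phi(\theta):=\log\lambda_\theta$, where $\lambda_\theta$ is the Perron--Frobenius eigenvalue (spectral radius) of the matrix $W(x|\bar x)e^{\theta g(x,\bar x)}$. Then $\phi$ is twice continuously differentiable near $0$ and, with $\eta(0):=\phi'(0)$, one has $\phi''(0)\ge 0$ and, as $n\to\infty$: (1) $\sqrt n\,\bigl(\tilde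 g^n/n-\eta(0)\bigr)$ converges in distribution to the normal distribution $N(0,\phi''(0))$ (the point mass at $0$ if $\phi''(0)=0$); (2) for every $\delta\in\mathbb R$, $\ \log \mathsf E\bigl[\exp\bigl(\delta\sqrt n(\tilde g^n/n-\eta(0))\bigr)\bigr]\to \delta^2\phi''(0)/2$; (3) if there are no $f:\mathcal X\to\mathbb R$ and $c\in\mathbb R$ with $g(x,\bar x)=f(x)-f(\bar x)+c$ for all $(x,\bar x)$ with $W(x|\bar x)>0$, then $\phi''(0)>0$ and, for every $\delta\in\mathbb R$, $$\lim_{n\to\infty}\Pr\bigl\{\tilde g^n-n\,\eta(0)\le\sqrt n\,\delta\bigr\}=\Phi\!\left(\frac{\delta}{\sqrt{\phi''(0)}}\right),\qquad \Phi(y):=\int_{-\infty}^y\frac{e^{-x^2/2}}{\sqrt{2\pi}}\,dx.$$ -/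

import Mathlib

open MeasureTheory ProbabilityTheory Filter Topology

noncomputable section

namespace MarkovCLT

/-- The entry `W x y` of a transition matrix is the probability `W(x|y)` of moving from `y` to `x`,
so transition matrices are the column-stochastic matrices.  Such a matrix is ergodic if it is
irreducible and no state has all its return times divisible by a common integer `d ≥ 2`. -/
structure IsErgodic {S : Type*} [Fintype S] [DecidableEq S] (W : Matrix S S ℝ) : Prop where
  irreducible : W.IsIrreducible
  aperiodic : ¬ ∃ (y : S) (d : ℕ), 2 ≤ d ∧ ∀ n : ℕ, (W ^ n) y y ≠ 0 → d ∣ n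

/-- The Perron-Frobenius eigenvalue of an entrywise nonnegative real matrix: its spectral radius
(the largest modulus of a complex eigenvalue). -/
def perronFrobenius {S : Type*} [Fintype S] [DecidableEq S] (A : Matrix S S ℝ) : ℝ :=
  (spectralRadius ℂ (A.map Complex.ofReal)).toReal

/-- The tilted matrix `W(x|y) exp(θ g(x,y))`. -/
def tilted {S : Type*} (W : Matrix S S ℝ) (g : S → S → ℝ) (θ : ℝ) : Matrix S S ℝ :=
  Matrix.of fun x y => W x y * Real.exp (θ * g x y)

/-- The potential function `φ(θ) = log λ_θ`, with `λ_θ` the Perron-Frobenius eigenvalue of the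
tilted matrix. -/
def potential {S : Type*} [Fintype S] [DecidableEq S] (W : Matrix S S ℝ) (g : S → S → ℝ)
    (θ : ℝ) : ℝ :=
  Real.log (perronFrobenius (tilted W g θ))

/-- The probability `P(x₁) W(x₂|x₁) ⋯ W(xₙ₊₁|xₙ)` of a path; the coordinate `i : Fin (n + 1)`
holds `x_{i+1}`. -/
def pathProb {S : Type*} (W : Matrix S S ℝ) (P : S → ℝ) (n : ℕ) (x : Fin (n + 1) → S) : ℝ :=
  P (x 0) * ∏ i : Fin n, W (x i.succ) (x i.castSucc)

theorem pathProb_nonneg {S : Type*} [Fintype S] [DecidableEq S] {W : Matrix S S ℝ} {P : S → ℝ}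
    (hW : W ∈ Matrix.colStochastic ℝ S) (hP : P ∈ stdSimplex ℝ S) (n : ℕ) (x : Fin (n + 1) → S) :
    0 ≤ pathProb W P n x :=
  mul_nonneg (hP.1 _) (Finset.prod_nonneg fun _ _ => Matrix.nonneg_of_mem_colStochastic hW)

theorem sum_pathProb {S : Type*} [Fintype S] [DecidableEq S] {W : Matrix S S ℝ} {P : S → ℝ}
    (hW : W ∈ Matrix.colStochastic ℝ S) (hP : P ∈ stdSimplex ℝ S) (n : ℕ) :
    ∑ x : Fin (n + 1) → S, pathProb W P n x = 1 := by
  induction n with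
  | zero =>
    rw [← (Equiv.funUnique (Fin 1) S).symm.sum_comp]
    simpa [pathProb] using hP.2
  | succ n ih =>
    rw [← (Fin.snocEquiv fun _ : Fin (n + 2) => S).sum_comp, Fintype.sum_prod_type,
      Finset.sum_comm, ← ih]
    refine Finset.sum_congr rfl fun x _ => ?_
    have key : ∀ y : S, pathProb W P (n + 1) (Fin.snocEquiv (fun _ : Fin (n + 2) => S) (y, x))
        = pathProb W P n x * W y (x (Fin.last n)) := by
      intro y
      have h0 : (Fin.snocEquiv (fun _ : Fin (n + 2) => S) (y, x)) 0 = x 0 :=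
        Fin.snoc_castSucc (α := fun _ => S) y x 0
      have h1 : ∀ i : Fin (n + 1),
          (Fin.snocEquiv (fun _ : Fin (n + 2) => S) (y, x)) i.castSucc = x i :=
        fun i => Fin.snoc_castSucc (α := fun _ => S) y x i
      have h2 : (Fin.snocEquiv (fun _ : Fin (n + 2) => S) (y, x)) (Fin.last (n + 1)) = y :=
        Fin.snoc_last (α := fun _ => S) y x
      unfold pathProb
      rw [Fin.prod_univ_castSucc, h0, Fin.succ_last, h2, h1]
      simp only [h1, Fin.succ_castSucc, mul_assoc]
    simp only [key]
    rw [← Finset.mul_sum, Matrix.sum_col_of_mem_colStochastic hW, mul_one]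

/-- The law `W^{×n} × P` of the first `n + 1` states of the Markov chain with initial distribution
`P` and transition matrix `W`. -/
def pathLaw {S : Type*} [Fintype S] [DecidableEq S] {W : Matrix S S ℝ} {P : S → ℝ}
    (hW : W ∈ Matrix.colStochastic ℝ S) (hP : P ∈ stdSimplex ℝ S) (n : ℕ) :
    PMF (Fin (n + 1) → S) :=
  PMF.ofFintype (fun x => ENNReal.ofReal (pathProb W P n x)) (by
    rw [← ENNReal.ofReal_sum_of_nonneg fun x _ => pathProb_nonneg hW hP n x,
      sum_pathProb hW hP, ENNReal.ofReal_one])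

/-- The additive functional `∑_{i=1}^n g(x_{i+1}, x_i) + h(x_1)`. -/
def additive {S : Type*} (g : S → S → ℝ) (h : S → ℝ) (n : ℕ) (x : Fin (n + 1) → S) : ℝ :=
  ∑ i : Fin n, g (x i.succ) (x i.castSucc) + h (x 0)

/-- The standard normal distribution function. -/
def stdNormalCDF (y : ℝ) : ℝ :=
  ∫ x in Set.Iic y, Real.exp (-x ^ 2 / 2) / √(2 * Real.pi)

end MarkovCLT

end

/-!
Write `g̃ⁿ` for the additive functional and `M_θ` for the matrix tilted by `θ`. Suppose that
`exp ψ_θ` is a left eigenvector of `M_θ` with eigenvalue `exp Λ(θ)`. Then the expectation of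
`exp(θ g̃ⁿ + ψ_θ(Xₙ₊₁))` is exactly `exp(n Λ(θ)) ∑ₓ P(x) exp(θ h(x) + ψ_θ(x))`. At `θ = z / √n` the
weight `exp ψ_θ` tends to `1`, so it may be dropped from the expectation, and after centring by
`η = Λ'(0)` the second-order expansion of `Λ` leaves `exp(z² Λ''(0) / 2)`. This holds for every
complex `z` (`tendsto_complexMGF`): for real `z` it is the convergence of the cumulant generating
functions, for imaginary `z` the central limit theorem by Lévy's continuity theorem.

Only the branch `(ψ_θ, Λ(θ))` through `(0, 0)` near `θ = 0` is needed. The inverse function theorem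
provides it over `ℂ` (`exists_perron_branch`), the linearized equation being the Poisson equation
of the chain. At real `θ` the branch is real by uniqueness, and a positive left eigenvector of a
nonnegative matrix belongs to the spectral radius (`perronFrobenius_eq_of_pos_left_eigenvector`),
so `Λ` extends the potential `φ` analytically.

For the variance, the eigenvalue equation reads `∑ₓ W(x|y) exp(k_θ(x, y)) = 1` with
`k_θ(x, y) = θ g(x, y) + ψ_θ(x) - ψ_θ(y) - φ(θ)`. Differentiating twice in `θ` at `0` (`sum_sq_eq`)
shows that the mean of `k_0'(·, y)²` is `φ''(0)` up to the drift of `ψ_0''`. Superharmonic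
functions of an irreducible chain are constant (`eq_of_superharmonic`), which gives `φ''(0) ≥ 0`;
and `φ''(0) = 0` forces `k_0' = 0` on possible transitions, that is, `g` is a coboundary up to a
constant (`nonneg_and_eq_zero_of_poisson_sq`).
-/

noncomputable section

namespace MarkovCLT

/-! ### Superharmonic functions of an irreducible chain -/

/-- A function that is superharmonic for an irreducible chain on a finite state space is constant:
superharmonicity passes to every power of `W`, and every state is reached from a minimum point. -/
theorem eq_of_superharmonic {S : Type*} [Fintype S] [DecidableEq S] {W : Matrix S S ℝ}
    (hW : W ∈ Matrix.colStochastic ℝ S) (hirr : W.IsIrreducible) {m : S → ℝ}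
    (hm : ∀ y, ∑ x, W x y * m x ≤ m y) (x y : S) : m x = m y := by
  have hpow : ∀ k : ℕ, ∀ y, ∑ x, (W ^ k) x y * m x ≤ m y := by
    intro k
    induction k with
    | zero => intro y; simp [Matrix.one_apply]
    | succ k ih =>
      intro y
      calc ∑ x, (W ^ (k + 1)) x y * m x = ∑ j, W j y * ∑ x, (W ^ k) x j * m x := by
            simp only [pow_succ, Matrix.mul_apply, Finset.sum_mul, Finset.mul_sum]
            rw [Finset.sum_comm]
            exact Finset.sum_congr rfl fun _ _ => Finset.sum_congr rfl fun _ _ => by ring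
        _ ≤ ∑ j, W j y * m j := Finset.sum_le_sum fun j _ =>
            mul_le_mul_of_nonneg_left (ih j) (hirr.nonneg j y)
        _ ≤ m y := hm y
  have : Nonempty S := ⟨x⟩
  obtain ⟨y₀, hy₀⟩ := Finite.exists_min m
  suffices h : ∀ i, m i = m y₀ by rw [h x, h y]
  intro i
  obtain ⟨k, -, hk⟩ := (Matrix.isIrreducible_iff_exists_pow_pos hirr.nonneg).1 hirr i y₀
  have hWk : W ^ k ∈ Matrix.colStochastic ℝ S := pow_mem hW k
  have hsum : ∑ x, (W ^ k) x y₀ * (m x - m y₀) ≤ 0 := by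
    simp only [mul_sub, Finset.sum_sub_distrib, ← Finset.sum_mul,
      Matrix.sum_col_of_mem_colStochastic hWk y₀, one_mul]
    linarith [hpow k y₀]
  have hnn : ∀ x ∈ Finset.univ, 0 ≤ (W ^ k) x y₀ * (m x - m y₀) := fun x _ =>
    mul_nonneg (Matrix.nonneg_of_mem_colStochastic hWk) (sub_nonneg.2 (hy₀ x))
  have h0 := (Finset.sum_eq_zero_iff_of_nonneg hnn).1
    (le_antisymm hsum (Finset.sum_nonneg hnn)) i (Finset.mem_univ i)
  linarith [(mul_eq_zero.1 h0).resolve_left hk.ne']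

/-- If the drift of `m` along the chain is a constant `c`, then `c = 0` and `m` is constant:
according to the sign of `c`, either `m` or `-m` is superharmonic. -/
theorem eq_zero_and_const_of_poisson {S : Type*} [Fintype S] [DecidableEq S] [Nonempty S]
    {W : Matrix S S ℝ}
    (hW : W ∈ Matrix.colStochastic ℝ S) (hirr : W.IsIrreducible) {m : S → ℝ} {c : ℝ}
    (hm : ∀ y, ∑ x, W x y * m x - m y = c) : c = 0 ∧ ∀ x y, m x = m y := by
  have hconst : ∀ x y, m x = m y := by
    rcases le_total c 0 with hc | hc
    · exact eq_of_superharmonic hW hirr fun y => by linarith [hm y]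
    · intro x y
      refine neg_injective (eq_of_superharmonic (m := fun x => -m x) hW hirr (fun y => ?_) x y)
      simp only [mul_neg, Finset.sum_neg_distrib]
      linarith [hm y]
  have y₀ : S := Classical.arbitrary S
  refine ⟨?_, hconst⟩
  rw [← hm y₀, Finset.sum_congr rfl fun x _ => by rw [hconst x y₀], ← Finset.sum_mul,
    Matrix.sum_col_of_mem_colStochastic hW, one_mul, sub_self]

/-! ### Spectral radius of a nonnegative matrix -/

/-- A positive left eigenvector of a nonnegative matrix belongs to the spectral radius: any
eigenvalue `z` with right eigenvector `v` satisfies `|z| ⟨l, |v|⟩ ≤ ⟨l, A |v|⟩ = r ⟨l, |v|⟩`. -/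
theorem perronFrobenius_eq_of_pos_left_eigenvector {S : Type*} [Fintype S] [DecidableEq S]
    [Nonempty S] {A : Matrix S S ℝ} (hA : ∀ x y, 0 ≤ A x y) {l : S → ℝ} (hl : ∀ x, 0 < l x)
    {r : ℝ} (h : ∀ y, ∑ x, l x * A x y = r * l y) : perronFrobenius A = r := by
  have y₀ : S := Classical.arbitrary S
  have hr : 0 ≤ r := by
    refine nonneg_of_mul_nonneg_left (b := l y₀) ?_ (hl y₀)
    rw [← h y₀]
    exact Finset.sum_nonneg fun x _ => mul_nonneg (hl x).le (hA x y₀)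
  have hmem : (r : ℂ) ∈ spectrum ℂ (A.map Complex.ofReal) := by
    rw [spectrum.mem_iff]
    intro hu
    have hz : Matrix.vecMul (fun x => (l x : ℂ))
        (algebraMap ℂ (Matrix S S ℂ) r - A.map Complex.ofReal) = 0 := by
      ext y
      have := congrArg (Complex.ofReal) (h y)
      push_cast at this
      simp [Matrix.vecMul, dotProduct, Matrix.algebraMap_matrix_apply, mul_sub, this,
        mul_comm (r : ℂ)]
    have := Matrix.vecMul_injective_of_isUnit hu (hz.trans (Matrix.zero_vecMul _).symm)
    have h1 := congrFun this y₀
    simp [(hl y₀).ne'] at h1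
  have hle : ∀ z ∈ spectrum ℂ (A.map Complex.ofReal), ‖z‖ ≤ r := by
    intro z hz
    rw [← Matrix.spectrum_toLin', ← Module.End.hasEigenvalue_iff_mem_spectrum] at hz
    obtain ⟨v, hv⟩ := hz.exists_hasEigenvector
    have hev : ∀ x, ∑ y, (A x y : ℂ) * v y = z * v x := fun x => by
      simpa [Matrix.mulVec, dotProduct] using congrFun hv.apply_eq_smul x
    obtain ⟨y₁, hy₁⟩ := Function.ne_iff.1 hv.2
    have hpos : 0 < ∑ x, l x * ‖v x‖ := Finset.sum_pos'
      (fun x _ => mul_nonneg (hl x).le (norm_nonneg _))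
      ⟨y₁, Finset.mem_univ _, mul_pos (hl y₁) (norm_pos_iff.2 hy₁)⟩
    refine le_of_mul_le_mul_right ?_ hpos
    calc ‖z‖ * ∑ x, l x * ‖v x‖ = ∑ x, l x * ‖∑ y, (A x y : ℂ) * v y‖ := by
          rw [Finset.mul_sum]
          exact Finset.sum_congr rfl fun x _ => by rw [hev, norm_mul]; ring
      _ ≤ ∑ x, l x * ∑ y, A x y * ‖v y‖ := Finset.sum_le_sum fun x _ =>
          mul_le_mul_of_nonneg_left ((norm_sum_le _ _).trans_eq
            (Finset.sum_congr rfl fun y _ => by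
              rw [norm_mul, Complex.norm_of_nonneg (hA x y)])) (hl x).le
      _ = ∑ y, (∑ x, l x * A x y) * ‖v y‖ := by
          simp only [Finset.mul_sum, Finset.sum_mul]
          rw [Finset.sum_comm]
          exact Finset.sum_congr rfl fun _ _ => Finset.sum_congr rfl fun _ _ => by ring
      _ = r * ∑ x, l x * ‖v x‖ := by
          rw [Finset.mul_sum]
          exact Finset.sum_congr rfl fun y _ => by rw [h]; ring
  have hrad : spectralRadius ℂ (A.map Complex.ofReal) = ENNReal.ofReal r := by
    refine le_antisymm (iSup₂_le fun z hz => ?_) ?_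
    · rw [← enorm_eq_nnnorm, ← ofReal_norm]
      exact ENNReal.ofReal_le_ofReal (hle z hz)
    · refine le_trans (le_of_eq ?_) (le_iSup₂ (f := fun z _ => ((‖z‖₊ : NNReal) : ENNReal)) _ hmem)
      rw [← enorm_eq_nnnorm, ← ofReal_norm, Complex.norm_of_nonneg hr]
  rw [perronFrobenius, hrad, ENNReal.toReal_ofReal hr]

/-! ### Derivatives of real restrictions of analytic functions -/

/-- If the analytic function `f` restricts to the real-valued `u` on the real axis near `0`, then so
does `deriv f` to `deriv u`; the statement can therefore be iterated. -/
theorem hasDerivAt_of_eq_ofReal {f : ℂ → ℂ} {u : ℝ → ℝ} (hf : AnalyticAt ℂ f 0)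
    (hu : ∀ᶠ t : ℝ in 𝓝 0, f t = u t) :
    ∀ᶠ t : ℝ in 𝓝 0, HasDerivAt u (deriv u t) t ∧ deriv f t = (deriv u t : ℝ) := by
  have hf' : ∀ᶠ t : ℝ in 𝓝 0, AnalyticAt ℂ f t :=
    (Complex.continuous_ofReal.tendsto' 0 0 rfl).eventually hf.eventually_analyticAt
  filter_upwards [hf', hu.eventually_nhds] with t ht hut
  have h1 : HasDerivAt (fun s : ℝ => f s) (deriv f t) t :=
    ht.differentiableAt.hasDerivAt.comp_ofReal
  have h2 : HasDerivAt (fun s : ℝ => (u s : ℂ)) (deriv f t) t := h1.congr_of_eventuallyEq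
    (hut.mono fun s hs => hs.symm)
  have h3 : HasDerivAt u (deriv f t).re t := by
    exact (Complex.reCLM.hasFDerivAt (x := (u t : ℂ))).comp_hasDerivAt t h2
  have h4 : deriv u t = (deriv f t).re := h3.deriv
  rw [h4]
  exact ⟨h3, h2.unique h3.ofReal_comp⟩

theorem contDiffAt_of_eq_ofReal {f : ℂ → ℂ} {u : ℝ → ℝ} (hf : AnalyticAt ℂ f 0)
    (hu : ∀ᶠ t : ℝ in 𝓝 0, f t = u t) :
    ContDiffAt ℝ 2 u 0 ∧ ((deriv u 0 : ℝ) : ℂ) = deriv f 0 ∧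
      ((iteratedDeriv 2 u 0 : ℝ) : ℂ) = iteratedDeriv 2 f 0 := by
  have h1 := hasDerivAt_of_eq_ofReal hf hu
  have h2 := hasDerivAt_of_eq_ofReal hf.deriv (h1.mono fun t ht => ht.2)
  refine ⟨?_, ?_, ?_⟩
  · have h : ContDiffAt ℝ 2 (fun t : ℝ => (f t).re) 0 :=
      ((hf.contDiffAt (n := 2)).real_of_complex (z := 0))
    exact h.congr_of_eventuallyEq (hu.mono fun t ht => by simp [ht])
  · simpa using h1.self_of_nhds.2.symm
  · rw [iteratedDeriv_succ, iteratedDeriv_one, iteratedDeriv_succ, iteratedDeriv_one]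
    simpa using h2.self_of_nhds.2.symm

/-! ### The analytic branch of the Perron-Frobenius eigenpair -/

/-- The map `(z, ψ, Λ) ↦ (z, (∑ₓ W(x|y) exp(z g(x,y) + ψ(x) - ψ(y) - Λ))_y, ∑ₓ ψ(x))`.  At a point
sent to `(z, 1, 0)`, the vector `exp ψ` is a left eigenvector of the tilted matrix with eigenvalue
`exp Λ`, normalized by `∑ ψ = 0`.  Keeping `z` as a coordinate lets the inverse function theorem
play the role of the implicit one. -/
def branchMap {S : Type*} [Fintype S] (W : Matrix S S ℝ) (g : S → S → ℝ)
    (p : ℂ × (S → ℂ) × ℂ) : ℂ × (S → ℂ) × ℂ :=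
  (p.1, fun y => ∑ x, (W x y : ℂ) * Complex.exp (p.1 * g x y + p.2.1 x - p.2.1 y - p.2.2),
    ∑ x, p.2.1 x)

theorem contDiff_branchMap {S : Type*} [Fintype S] (W : Matrix S S ℝ) (g : S → S → ℝ) :
    ContDiff ℂ ⊤ (branchMap W g) := by
  unfold branchMap
  fun_prop

theorem fderiv_branchMap_apply {S : Type*} [Fintype S] (W : Matrix S S ℝ) (g : S → S → ℝ)
    (v : ℂ × (S → ℂ) × ℂ) :
    fderiv ℂ (branchMap W g) 0 v =
      (v.1, fun y => ∑ x, (W x y : ℂ) * (v.1 * g x y + v.2.1 x - v.2.1 y - v.2.2),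
        ∑ x, v.2.1 x) := by
  -- the components are computed along the line `t ↦ t • v`
  have hd : HasFDerivAt (branchMap W g) (fderiv ℂ (branchMap W g) 0) ((0 : ℂ) • v) := by
    rw [zero_smul]
    exact ((contDiff_branchMap W g).differentiable (by simp) 0).hasFDerivAt
  have h1 : HasDerivAt (fun t : ℂ => t • v) v 0 := by
    simpa using (hasDerivAt_id (0 : ℂ)).smul_const v
  have h2 := hd.comp_hasDerivAt (0 : ℂ) h1
  refine h2.unique (HasDerivAt.prodMk ?_ (HasDerivAt.prodMk (hasDerivAt_pi.2 fun y => ?_) ?_))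
  · simpa [branchMap] using (hasDerivAt_id (0 : ℂ)).mul_const v.1
  · refine HasDerivAt.fun_sum fun x _ => HasDerivAt.const_mul _ ?_
    have h3 : HasDerivAt (fun t : ℂ => t * (v.1 * g x y + v.2.1 x - v.2.1 y - v.2.2))
        (v.1 * g x y + v.2.1 x - v.2.1 y - v.2.2) 0 := by
      simpa using (hasDerivAt_id (0 : ℂ)).mul_const (v.1 * g x y + v.2.1 x - v.2.1 y - v.2.2)
    have h4 := h3.cexp
    simp only [zero_mul, Complex.exp_zero, one_mul] at h4
    refine h4.congr_of_eventuallyEq (Eventually.of_forall fun t => ?_)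
    simp only [Prod.smul_fst, Prod.smul_snd, Pi.smul_apply, smul_eq_mul]
    ring_nf
  · refine HasDerivAt.fun_sum fun x _ => ?_
    simpa using (hasDerivAt_id (0 : ℂ)).mul_const (v.2.1 x)

/-- In the kernel of the derivative at `0`, `ψ` has constant drift `Λ` along the chain, so that
`Λ = 0` and `ψ` is a constant of sum zero. -/
theorem fderiv_branchMap_injective {S : Type*} [Fintype S] [DecidableEq S] [Nonempty S]
    {W : Matrix S S ℝ} (hW : W ∈ Matrix.colStochastic ℝ S) (hirr : W.IsIrreducible)
    (g : S → S → ℝ) : Function.Injective (fderiv ℂ (branchMap W g) 0) := by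
  rw [injective_iff_map_eq_zero]
  rintro ⟨z, m, c⟩ h
  rw [fderiv_branchMap_apply] at h
  simp only [Prod.mk_eq_zero] at h
  obtain ⟨rfl, h1, h2⟩ := h
  have hP : ∀ y, ∑ x, (W x y : ℂ) * m x - m y = c := fun y => by
    have h3 := congrFun h1 y
    have h4 := congrArg Complex.ofReal (Matrix.sum_col_of_mem_colStochastic hW y)
    push_cast at h4
    simp only [zero_mul, zero_add, mul_sub, Finset.sum_sub_distrib, ← Finset.sum_mul, h4, one_mul,
      Pi.zero_apply] at h3
    linear_combination h3
  obtain ⟨hcr, hmr⟩ := eq_zero_and_const_of_poisson hW hirr (m := fun x => (m x).re) (c := c.re)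
    (fun y => by simpa using congrArg Complex.re (hP y))
  obtain ⟨hci, hmi⟩ := eq_zero_and_const_of_poisson hW hirr (m := fun x => (m x).im) (c := c.im)
    (fun y => by simpa using congrArg Complex.im (hP y))
  have hm : m = 0 := by
    ext y
    rw [Finset.sum_congr rfl fun x _ => Complex.ext (hmr x y) (hmi x y)] at h2
    simpa using h2
  have hc : c = 0 := Complex.ext hcr hci
  simp [hm, hc]

theorem branchMap_conj {S : Type*} [Fintype S] (W : Matrix S S ℝ) (g : S → S → ℝ)
    (p : ℂ × (S → ℂ) × ℂ) : branchMap W g (star p) = star (branchMap W g p) := by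
  ext
  · simp [branchMap]
  · simp [branchMap, ← Complex.exp_conj]
  · simp [branchMap]

/-- Analytic continuation of the Perron-Frobenius eigenpair `(exp ψ, exp Λ)` of the tilted matrix to
complex parameters near `0`; it is real at real parameters. -/
theorem exists_perron_branch {S : Type*} [Fintype S] [DecidableEq S] [Nonempty S]
    {W : Matrix S S ℝ} (hW : W ∈ Matrix.colStochastic ℝ S) (hirr : W.IsIrreducible)
    (g : S → S → ℝ) : ∃ (ψ : S → ℂ → ℂ) (Λ : ℂ → ℂ),
      (∀ x, AnalyticAt ℂ (ψ x) 0) ∧ AnalyticAt ℂ Λ 0 ∧ (∀ x, ψ x 0 = 0) ∧ Λ 0 = 0 ∧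
      (∀ᶠ z in 𝓝 0, ∀ y,
        ∑ x, (W x y : ℂ) * Complex.exp (z * g x y + ψ x z - ψ y z - Λ z) = 1) ∧
      (∀ᶠ t : ℝ in 𝓝 0, Λ t = (Λ t).re ∧ ∀ x, ψ x t = (ψ x t).re) := by
  have hcd : ContDiffAt ℂ ⊤ (branchMap W g) 0 := (contDiff_branchMap W g).contDiffAt
  let L : (ℂ × (S → ℂ) × ℂ) ≃L[ℂ] (ℂ × (S → ℂ) × ℂ) :=
    (LinearEquiv.ofInjectiveEndo (fderiv ℂ (branchMap W g) 0).toLinearMap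
      (fderiv_branchMap_injective hW hirr g)).toContinuousLinearEquiv
  have hL : HasFDerivAt (branchMap W g) (L : (ℂ × (S → ℂ) × ℂ) →L[ℂ] (ℂ × (S → ℂ) × ℂ)) 0 :=
    (hcd.differentiableAt (by simp)).hasFDerivAt
  have hs := hcd.hasStrictFDerivAt' hL (by simp)
  have h0 : branchMap W g 0 = (0, 1, 0) := by
    ext y
    · simp [branchMap]
    · simpa [branchMap] using
        congrArg Complex.ofReal (Matrix.sum_col_of_mem_colStochastic hW y)
    · simp [branchMap]
  let G := hs.localInverse (branchMap W g) L 0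
  let q : ℂ → ℂ × (S → ℂ) × ℂ := fun z => G (z, 1, 0)
  have hq0 : q 0 = 0 := by
    simp only [q, ← h0]
    exact hs.localInverse_apply_image
  have hqa : AnalyticAt ℂ q 0 := by
    have h1 : ContDiffAt ℂ ⊤ G (0, 1, 0) := h0 ▸ hcd.to_localInverse hL (by simp)
    have h2 : ContDiffAt ℂ ⊤ q 0 := h1.comp (x := (0 : ℂ))
      (f := fun z : ℂ => (z, (1 : S → ℂ), (0 : ℂ)))
      (by fun_prop)
    exact h2.analyticAt
  have hqc : Tendsto q (𝓝 0) (𝓝 0) := by simpa [hq0] using hqa.continuousAt.tendsto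
  have hqr : ∀ᶠ z in 𝓝 (0 : ℂ), branchMap W g (q z) = (z, 1, 0) := by
    have h1 := hs.eventually_right_inverse
    rw [h0] at h1
    have h2 : Tendsto (fun z : ℂ => (z, (1 : S → ℂ), (0 : ℂ))) (𝓝 0) (𝓝 (0, 1, 0)) :=
      Continuous.tendsto' (by fun_prop) _ _ rfl
    exact h2.eventually h1
  have hq1 : ∀ᶠ z in 𝓝 (0 : ℂ), (q z).1 = z := hqr.mono fun z hz => by
    simpa [branchMap] using congrArg Prod.fst hz
  -- the complex conjugate of a solution at a real parameter is a solution, hence the same one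
  have hreal : ∀ᶠ t : ℝ in 𝓝 0, star (q t) = q t := by
    have hof : Tendsto (fun t : ℝ => (t : ℂ)) (𝓝 0) (𝓝 0) :=
      Complex.continuous_ofReal.tendsto' 0 0 rfl
    have hst : Tendsto (fun t : ℝ => star (q t)) (𝓝 0) (𝓝 0) := by
      rw [← star_zero (ℂ × (S → ℂ) × ℂ)]
      exact (continuous_star.tendsto _).comp (hqc.comp hof)
    filter_upwards [hst.eventually hs.eventually_left_inverse, hof.eventually hqr] with t h1 h2
    rw [← h1, branchMap_conj, h2]
    have h3 : star ((t : ℂ), (1 : S → ℂ), (0 : ℂ)) = ((t : ℂ), (1 : S → ℂ), (0 : ℂ)) := by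
      ext <;> simp
    rw [h3]
  refine ⟨fun x z => (q z).2.1 x, fun z => (q z).2.2, fun x => ?_, ?_, ?_, ?_, ?_, ?_⟩
  · have h1 : ContDiffAt ℂ ⊤ q 0 := hqa.contDiffAt
    exact (show ContDiffAt ℂ ⊤ (fun z => (q z).2.1 x) 0 by fun_prop).analyticAt
  · have h1 : ContDiffAt ℂ ⊤ q 0 := hqa.contDiffAt
    exact (show ContDiffAt ℂ ⊤ (fun z => (q z).2.2) 0 by fun_prop).analyticAt
  · simp [hq0]
  · simp [hq0]
  · filter_upwards [hqr, hq1] with z h1 h2 y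
    have h3 := congrFun (congrArg (fun p => p.2.1) h1) y
    simpa [branchMap, h2] using h3
  · filter_upwards [hreal] with t ht
    exact ⟨(Complex.conj_eq_iff_re.1 (congrArg (fun p => p.2.2) ht)).symm, fun x =>
      (Complex.conj_eq_iff_re.1 (congrFun (congrArg (fun p => p.2.1) ht) x)).symm⟩

theorem eventually_potential_eq {S : Type*} [Fintype S] [DecidableEq S] [Nonempty S]
    {W : Matrix S S ℝ} (hW : ∀ x y, 0 ≤ W x y) {g : S → S → ℝ} {u : S → ℝ → ℝ} {φ : ℝ → ℝ}
    (h : ∀ᶠ t : ℝ in 𝓝 0, ∀ y, ∑ x, W x y * Real.exp (t * g x y + u x t - u y t - φ t) = 1) :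
    ∀ᶠ t : ℝ in 𝓝 0, potential W g t = φ t := by
  filter_upwards [h] with t ht
  rw [potential, perronFrobenius_eq_of_pos_left_eigenvector (A := tilted W g t)
    (l := fun x => Real.exp (u x t))
    (r := Real.exp (φ t)) (fun x y => mul_nonneg (hW x y) (Real.exp_pos _).le)
    (fun x => Real.exp_pos _), Real.log_exp]
  intro y
  rw [← mul_one (Real.exp (φ t) * _), ← ht y, Finset.mul_sum]
  refine Finset.sum_congr rfl fun x _ => ?_
  rw [tilted, Matrix.of_apply, mul_left_comm, mul_left_comm (Real.exp (φ t) * _), ← Real.exp_add,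
    ← Real.exp_add, ← Real.exp_add]
  ring_nf

/-- The analytic branch together with its real restriction, in which the logarithm `Λ` of the
eigenvalue is the potential. -/
theorem exists_real_perron_branch {S : Type*} [Fintype S] [DecidableEq S] [Nonempty S]
    {W : Matrix S S ℝ} (hW : W ∈ Matrix.colStochastic ℝ S) (hirr : W.IsIrreducible)
    (g : S → S → ℝ) : ∃ (ψ : S → ℂ → ℂ) (Λ : ℂ → ℂ) (u : S → ℝ → ℝ),
      (∀ x, AnalyticAt ℂ (ψ x) 0) ∧ AnalyticAt ℂ Λ 0 ∧ (∀ x, ψ x 0 = 0) ∧ Λ 0 = 0 ∧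
      (∀ᶠ z in 𝓝 0, ∀ y,
        ∑ x, (W x y : ℂ) * Complex.exp (z * g x y + ψ x z - ψ y z - Λ z) = 1) ∧
      (∀ᶠ t : ℝ in 𝓝 0, Λ t = potential W g t) ∧
      (∀ x, ∀ᶠ t : ℝ in 𝓝 0, ψ x t = u x t) ∧
      (∀ᶠ t : ℝ in 𝓝 0, ∀ y,
        ∑ x, W x y * Real.exp (t * g x y + u x t - u y t - potential W g t) = 1) := by
  obtain ⟨ψ, Λ, hψ, hΛ, hψ0, hΛ0, heq, hreal⟩ := exists_perron_branch hW hirr g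
  have hof : Tendsto (fun t : ℝ => (t : ℂ)) (𝓝 0) (𝓝 0) :=
    Complex.continuous_ofReal.tendsto' 0 0 rfl
  have heqr : ∀ᶠ t : ℝ in 𝓝 0, ∀ y,
      ∑ x, W x y * Real.exp (t * g x y + (ψ x t).re - (ψ y t).re - (Λ t).re) = 1 := by
    filter_upwards [hof.eventually heq, hreal] with t h1 h2 y
    have h3 := h1 y
    rw [h2.1, h2.2 y, Finset.sum_congr rfl fun x _ => by rw [h2.2 x]] at h3
    exact_mod_cast h3
  have hpot := eventually_potential_eq hirr.nonneg heqr
  refine ⟨ψ, Λ, fun x t => (ψ x t).re, hψ, hΛ, hψ0, hΛ0, heq, ?_, fun x => ?_, ?_⟩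
  · filter_upwards [hreal, hpot] with t h1 h2
    rw [h2, h1.1, Complex.ofReal_re]
  · exact hreal.mono fun t ht => ht.2 x
  · filter_upwards [heqr, hpot] with t h1 h2
    rwa [h2]

/-! ### The variance -/

/-- The second derivative at `0` of a weighted sum `∑ wᵢ exp(kᵢ(t))` that is constant. -/
theorem second_deriv_sum_exp {ι : Type*} [Fintype ι] {w : ι → ℝ} {k k' : ι → ℝ → ℝ} {k₂ : ι → ℝ}
    (h0 : ∀ i, k i 0 = 0) (h1 : ∀ i, ∀ᶠ t in 𝓝 0, HasDerivAt (k i) (k' i t) t)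
    (h2 : ∀ i, HasDerivAt (k' i) (k₂ i) 0)
    (h : ∀ᶠ t in 𝓝 0, ∑ i, w i * Real.exp (k i t) = 1) :
    ∑ i, w i * (k' i 0 ^ 2 + k₂ i) = 0 := by
  have hF : ∀ᶠ t in 𝓝 0, ∑ i, w i * (Real.exp (k i t) * k' i t) = 0 := by
    filter_upwards [eventually_all.2 h1, h.eventually_nhds] with t ht hct
    have hd : HasDerivAt (fun s => ∑ i, w i * Real.exp (k i s))
        (∑ i, w i * (Real.exp (k i t) * k' i t)) t :=
      HasDerivAt.fun_sum fun i _ => ((ht i).exp).const_mul (w i)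
    exact hd.unique ((hasDerivAt_const t (1 : ℝ)).congr_of_eventuallyEq hct)
  have hd : HasDerivAt (fun s => ∑ i, w i * (Real.exp (k i s) * k' i s))
      (∑ i, w i * (Real.exp (k i 0) * k' i 0 * k' i 0 + Real.exp (k i 0) * k₂ i)) 0 :=
    HasDerivAt.fun_sum fun i _ => (((h1 i).self_of_nhds.exp).mul (h2 i)).const_mul (w i)
  refine Eq.trans ?_ (hd.unique ((hasDerivAt_const 0 (0 : ℝ)).congr_of_eventuallyEq hF))
  refine Finset.sum_congr rfl fun i _ => ?_
  rw [h0, Real.exp_zero]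
  ring

theorem hasDerivAt_of_contDiffAt_two {u : ℝ → ℝ} (hu : ContDiffAt ℝ 2 u 0) :
    (∀ᶠ t in 𝓝 0, HasDerivAt u (deriv u t) t) ∧
      HasDerivAt (deriv u) (iteratedDeriv 2 u 0) 0 := by
  constructor
  · filter_upwards [hu.eventually (by simp)] with t ht
    exact (ht.differentiableAt (by simp)).hasDerivAt
  · have h1 : ContDiffAt ℝ 1 (deriv u) 0 := by
      simpa using hu.derivWithin (m := 1) (by norm_num)
    rw [iteratedDeriv_succ, iteratedDeriv_one]
    exact (h1.differentiableAt (by simp)).hasDerivAt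

/-- With the eigenvalue equation written as `∑ₓ W(x|y) exp(k(t)) = 1`, its second derivative at `0`
expresses the mean square of `k'(0)` through the curvature `φ''(0)` up to the drift of `u''(0)`. -/
theorem sum_sq_eq {S : Type*} [Fintype S] [DecidableEq S] {W : Matrix S S ℝ}
    (hW : W ∈ Matrix.colStochastic ℝ S) {g : S → S → ℝ} {u : S → ℝ → ℝ} {φ : ℝ → ℝ}
    (hu : ∀ x, ContDiffAt ℝ 2 (u x) 0) (hφ : ContDiffAt ℝ 2 φ 0)
    (hu0 : ∀ x, u x 0 = 0) (hφ0 : φ 0 = 0)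
    (h : ∀ᶠ t : ℝ in 𝓝 0, ∀ y, ∑ x, W x y * Real.exp (t * g x y + u x t - u y t - φ t) = 1)
    (y : S) :
    ∑ x, W x y * (g x y + deriv (u x) 0 - deriv (u y) 0 - deriv φ 0) ^ 2 =
      iteratedDeriv 2 φ 0 + iteratedDeriv 2 (u y) 0 - ∑ x, W x y * iteratedDeriv 2 (u x) 0 := by
  have hd := fun x => hasDerivAt_of_contDiffAt_two (hu x)
  obtain ⟨hφ1, hφ2⟩ := hasDerivAt_of_contDiffAt_two hφ
  have key := second_deriv_sum_exp (w := fun x => W x y)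
    (k := fun x t => t * g x y + u x t - u y t - φ t)
    (k' := fun x t => g x y + deriv (u x) t - deriv (u y) t - deriv φ t)
    (k₂ := fun x => iteratedDeriv 2 (u x) 0 - iteratedDeriv 2 (u y) 0 - iteratedDeriv 2 φ 0)
    (fun x => by simp [hu0, hφ0])
    (fun x => by
      filter_upwards [(hd x).1, (hd y).1, hφ1] with t h1 h2 h3
      exact (((by simpa using (hasDerivAt_id t).mul_const (g x y) :
        HasDerivAt (fun t => t * g x y) (g x y) t).add h1).sub h2).sub h3)
    (fun x => (((hd x).2.const_add _).sub (hd y).2).sub hφ2)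
    (h.mono fun t ht => ht y)
  have hs := Matrix.sum_col_of_mem_colStochastic hW y
  simp only [mul_add, mul_sub, Finset.sum_add_distrib, Finset.sum_sub_distrib, ← Finset.sum_mul,
    hs, one_mul] at key
  linarith

/-- If the conditional mean squares of `a` are `v` up to the drift of a function `m`, then `v ≥ 0`,
with equality only if `a` vanishes on all possible transitions: for `v ≤ 0` the function `m` is
superharmonic, hence constant, and drops out. -/
theorem nonneg_and_eq_zero_of_poisson_sq {S : Type*} [Fintype S] [DecidableEq S] [Nonempty S]
    {W : Matrix S S ℝ} (hW : W ∈ Matrix.colStochastic ℝ S) {a : S → S → ℝ} {m : S → ℝ} {v : ℝ}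
    (hirr : W.IsIrreducible)
    (h : ∀ y, ∑ x, W x y * a x y ^ 2 = v + m y - ∑ x, W x y * m x) :
    0 ≤ v ∧ (v = 0 → ∀ x y, 0 < W x y → a x y = 0) := by
  have hnn : ∀ x y, 0 ≤ W x y * a x y ^ 2 := fun x y => mul_nonneg (hirr.nonneg x y) (sq_nonneg _)
  have hconst : v ≤ 0 → ∀ y, ∑ x, W x y * a x y ^ 2 = v := by
    intro hv y
    have hm := eq_of_superharmonic (m := m) hW hirr fun y => by
      linarith [h y, Finset.sum_nonneg fun x (_ : x ∈ Finset.univ) => hnn x y]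
    rw [h y, Finset.sum_congr rfl fun x _ => by rw [hm x y], ← Finset.sum_mul,
      Matrix.sum_col_of_mem_colStochastic hW]
    ring
  constructor
  · by_contra! hv
    have y : S := Classical.arbitrary S
    linarith [hconst hv.le y, Finset.sum_nonneg fun x (_ : x ∈ Finset.univ) => hnn x y]
  · intro hv x y hxy
    have h0 := (Finset.sum_eq_zero_iff_of_nonneg fun x _ => hnn x y).1
      ((hconst hv.le y).trans hv) x (Finset.mem_univ x)
    exact pow_eq_zero_iff two_ne_zero |>.1 ((mul_eq_zero.1 h0).resolve_left hxy.ne')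

/-! ### Asymptotics at the scale `1 / √n` -/

theorem tendsto_div_sqrt (z : ℂ) :
    Tendsto (fun n : ℕ => z / ((√(n : ℝ) : ℝ) : ℂ)) atTop (𝓝 0) := by
  rw [tendsto_zero_iff_norm_tendsto_zero]
  have h := (tendsto_const_nhds (x := ‖z‖)).div_atTop
    (Real.tendsto_sqrt_atTop.comp tendsto_natCast_atTop_atTop)
  refine h.congr fun n => ?_
  simp [abs_of_nonneg (Real.sqrt_nonneg _)]

/-- Second-order expansion of `Λ` at the scale `z / √n`. -/
theorem tendsto_second_order {Λ : ℂ → ℂ} (hΛ : AnalyticAt ℂ Λ 0) (h0 : Λ 0 = 0) (z : ℂ) :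
    Tendsto (fun n : ℕ => n * Λ (z / ((√(n : ℝ) : ℝ) : ℂ)) - z * ((√(n : ℝ) : ℝ) : ℂ) * deriv Λ 0)
      atTop (𝓝 (z ^ 2 * iteratedDeriv 2 Λ 0 / 2)) := by
  -- the remainder is `O(n |z / √n|³) = O(n^(-1/2))`
  have hO := (hΛ.hasFPowerSeriesAt.isBigO_sub_partialSum_pow 3).comp_tendsto (tendsto_div_sqrt z)
  have hO2 := (Asymptotics.isBigO_of_le (g := fun n : ℕ => (n : ℝ)) atTop
    fun n => (by simp : ‖(n : ℂ)‖ ≤ ‖(n : ℝ)‖)).mul hO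
  have hsq : ∀ᶠ n : ℕ in atTop, 0 < √(n : ℝ) := by
    filter_upwards [eventually_gt_atTop 0] with n hn
    exact Real.sqrt_pos.2 (Nat.cast_pos.2 hn)
  have hz : Tendsto (fun n : ℕ => (n : ℝ) * ((fun y : ℂ => ‖y‖ ^ 3) ∘
      fun n : ℕ => z / ((√(n : ℝ) : ℝ) : ℂ)) n) atTop (𝓝 0) := by
    have h := (tendsto_const_nhds (x := ‖z‖ ^ 3)).div_atTop
      (Real.tendsto_sqrt_atTop.comp tendsto_natCast_atTop_atTop)
    refine h.congr' ?_
    filter_upwards [hsq] with n hn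
    have h2 : (n : ℝ) = √(n : ℝ) ^ 2 := (Real.sq_sqrt (Nat.cast_nonneg n)).symm
    simp only [Function.comp_apply, Complex.norm_real, norm_div, Real.norm_of_nonneg hn.le]
    generalize √(n : ℝ) = s at *
    rw [h2]
    field_simp
  have key := (hO2.trans_tendsto hz).add_const (z ^ 2 * iteratedDeriv 2 Λ 0 / 2)
  rw [zero_add] at key
  refine key.congr' ?_
  filter_upwards [hsq] with n hn
  have h2 : (n : ℂ) = ((√(n : ℝ) : ℝ) : ℂ) ^ 2 := by
    rw [← Complex.ofReal_pow, Real.sq_sqrt (Nat.cast_nonneg n), Complex.ofReal_natCast]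
  have hs : ((√(n : ℝ) : ℝ) : ℂ) ≠ 0 := Complex.ofReal_ne_zero.2 hn.ne'
  simp only [Function.comp_apply, FormalMultilinearSeries.partialSum, Finset.sum_range_succ,
    Finset.sum_range_zero, FormalMultilinearSeries.ofScalars_apply_eq, iteratedDeriv_zero, h0,
    iteratedDeriv_one, zero_add]
  generalize ((√(n : ℝ) : ℝ) : ℂ) = s at *
  rw [h2]
  simp
  field_simp
  ring

/-! ### Path sums and moment generating functions -/

/-- The expectation `E[exp(z g̃ⁿ) f(Xₙ₊₁)]`, as a sum over paths. -/
def pathSum {S : Type*} [Fintype S] (W : Matrix S S ℝ) (P : S → ℝ) (g : S → S → ℝ) (h : S → ℝ)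
    (z : ℂ) (n : ℕ) (f : S → ℂ) : ℂ :=
  ∑ x : Fin (n + 1) → S, pathProb W P n x * Complex.exp (z * additive g h n x) * f (x (Fin.last n))

theorem pathSum_zero {S : Type*} [Fintype S] (W : Matrix S S ℝ) (P : S → ℝ) (g : S → S → ℝ)
    (h : S → ℝ) (z : ℂ) (f : S → ℂ) :
    pathSum W P g h z 0 f = ∑ x, P x * Complex.exp (z * h x) * f x := by
  rw [pathSum, ← (Equiv.funUnique (Fin 1) S).symm.sum_comp]
  simp [pathProb, additive]

theorem pathSum_succ {S : Type*} [Fintype S] (W : Matrix S S ℝ) (P : S → ℝ) (g : S → S → ℝ)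
    (h : S → ℝ) (z : ℂ) (n : ℕ) (f : S → ℂ) :
    pathSum W P g h z (n + 1) f =
      pathSum W P g h z n fun y => ∑ x, W x y * Complex.exp (z * g x y) * f x := by
  -- split off the last state of the path
  rw [pathSum, ← (Fin.snocEquiv fun _ : Fin (n + 2) => S).sum_comp, Fintype.sum_prod_type,
    Finset.sum_comm, pathSum]
  refine Finset.sum_congr rfl fun x _ => ?_
  rw [Finset.mul_sum]
  refine Finset.sum_congr rfl fun y _ => ?_
  have h0 : (Fin.snocEquiv (fun _ : Fin (n + 2) => S) (y, x)) 0 = x 0 :=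
    Fin.snoc_castSucc (α := fun _ => S) y x 0
  have h1 : ∀ i : Fin (n + 1),
      (Fin.snocEquiv (fun _ : Fin (n + 2) => S) (y, x)) i.castSucc = x i :=
    fun i => Fin.snoc_castSucc (α := fun _ => S) y x i
  have h2 : (Fin.snocEquiv (fun _ : Fin (n + 2) => S) (y, x)) (Fin.last (n + 1)) = y :=
    Fin.snoc_last (α := fun _ => S) y x
  have hp : pathProb W P (n + 1) (Fin.snocEquiv (fun _ : Fin (n + 2) => S) (y, x)) =
      pathProb W P n x * W y (x (Fin.last n)) := by
    unfold pathProb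
    rw [Fin.prod_univ_castSucc, h0, Fin.succ_last, h2, h1]
    simp only [h1, Fin.succ_castSucc, mul_assoc]
  have ha : additive g h (n + 1) (Fin.snocEquiv (fun _ : Fin (n + 2) => S) (y, x)) =
      additive g h n x + g y (x (Fin.last n)) := by
    unfold additive
    rw [Fin.sum_univ_castSucc, h0, Fin.succ_last, h2, h1]
    simp only [h1, Fin.succ_castSucc]
    ring
  rw [hp, ha, h2]
  push_cast
  rw [mul_add, Complex.exp_add]
  ring

theorem pathSum_eigenvector {S : Type*} [Fintype S] (W : Matrix S S ℝ) (P : S → ℝ)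
    (g : S → S → ℝ) (h : S → ℝ) {z l : ℂ} {f : S → ℂ}
    (hf : ∀ y, ∑ x, W x y * Complex.exp (z * g x y) * f x = l * f y) (n : ℕ) :
    pathSum W P g h z n f = l ^ n * ∑ x, P x * Complex.exp (z * h x) * f x := by
  induction n with
  | zero => simp [pathSum_zero]
  | succ n ih =>
    rw [pathSum_succ, funext hf, pow_succ', mul_assoc, ← ih, pathSum, pathSum, Finset.mul_sum]
    exact Finset.sum_congr rfl fun _ _ => by ring

/-- The standardized additive functional `√n (g̃ⁿ / n - η)`. -/
def standardized {S : Type*} (g : S → S → ℝ) (h : S → ℝ) (η : ℝ) (n : ℕ)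
    (x : Fin (n + 1) → S) : ℝ :=
  √(n : ℝ) * (additive g h n x / n - η)

theorem complexMGF_pathLaw {S : Type*} [Fintype S] [DecidableEq S] [MeasurableSpace S]
    [DiscreteMeasurableSpace S] {W : Matrix S S ℝ} (hW : W ∈ Matrix.colStochastic ℝ S) {P : S → ℝ}
    (hP : P ∈ stdSimplex ℝ S)
    (n : ℕ) (X : (Fin (n + 1) → S) → ℝ) (z : ℂ) :
    complexMGF X (pathLaw hW hP n).toMeasure z =
      ∑ x, pathProb W P n x * Complex.exp (z * X x) := by
  rw [complexMGF, PMF.integral_eq_sum]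
  refine Finset.sum_congr rfl fun x _ => ?_
  rw [pathLaw, PMF.ofFintype_apply, ENNReal.toReal_ofReal (pathProb_nonneg hW hP n x),
    Complex.real_smul]

theorem mul_standardized {S : Type*} (g : S → S → ℝ) (h : S → ℝ) (η : ℝ) {n : ℕ} (hn : 0 < n)
    (x : Fin (n + 1) → S) (z : ℂ) :
    z * (standardized g h η n x : ℝ) =
      z / ((√(n : ℝ) : ℝ) : ℂ) * (additive g h n x : ℝ) - z * ((√(n : ℝ) : ℝ) : ℂ) * η := by
  have hs : ((√(n : ℝ) : ℝ) : ℂ) ≠ 0 :=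
    Complex.ofReal_ne_zero.2 (Real.sqrt_pos.2 (Nat.cast_pos.2 hn)).ne'
  have h2 : (n : ℂ) = ((√(n : ℝ) : ℝ) : ℂ) ^ 2 := by
    rw [← Complex.ofReal_pow, Real.sq_sqrt (Nat.cast_nonneg n), Complex.ofReal_natCast]
  rw [standardized]
  push_cast
  rw [h2]
  field_simp

/-- Replacing the final weight `1` by the eigenvector `exp ψ` makes the expectation explicit.  The
error is dominated by the moment generating function at `Re z`, times the distance from `exp ψ` to
`1`. -/
theorem norm_complexMGF_sub_le {S : Type*} [Fintype S] [DecidableEq S] [MeasurableSpace S]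
    [DiscreteMeasurableSpace S] {W : Matrix S S ℝ} (hW : W ∈ Matrix.colStochastic ℝ S) {P : S → ℝ}
    (hP : P ∈ stdSimplex ℝ S)
    (g : S → S → ℝ) (h : S → ℝ) (η : ℝ) {n : ℕ} (hn : 0 < n) (z L : ℂ)
    (ψ : S → ℂ)
    (hψ : ∀ y, ∑ x, (W x y : ℂ) * Complex.exp
      (z / ((√(n : ℝ) : ℝ) : ℂ) * g x y + ψ x - ψ y - L) = 1) :
    ‖complexMGF (standardized g h η n) (pathLaw hW hP n).toMeasure z -
        Complex.exp (n * L - z * ((√(n : ℝ) : ℝ) : ℂ) * η) *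
          ∑ x, P x * Complex.exp (z / ((√(n : ℝ) : ℝ) : ℂ) * h x) * Complex.exp (ψ x)‖ ≤
      (∑ x, ‖1 - Complex.exp (ψ x)‖) *
        mgf (standardized g h η n) (pathLaw hW hP n).toMeasure z.re := by
  set a : ℂ := z / ((√(n : ℝ) : ℝ) : ℂ)
  have hf : ∀ y, ∑ x, W x y * Complex.exp (a * g x y) * Complex.exp (ψ x) =
      Complex.exp L * Complex.exp (ψ y) := fun y => by
    rw [← mul_one (Complex.exp L * _), ← hψ y, Finset.mul_sum]
    refine Finset.sum_congr rfl fun x _ => ?_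
    have hexp : Complex.exp (a * g x y) * Complex.exp (ψ x) = Complex.exp L * Complex.exp (ψ y) *
        Complex.exp (a * g x y + ψ x - ψ y - L) := by
      simp only [← Complex.exp_add]
      ring_nf
    rw [mul_assoc, hexp]
    ring
  have hX := fun x => mul_standardized g h η hn x z
  have hmain : Complex.exp (n * L - z * ((√(n : ℝ) : ℝ) : ℂ) * η) *
      ∑ x, P x * Complex.exp (a * h x) * Complex.exp (ψ x) =
      ∑ x, pathProb W P n x * Complex.exp (z * (standardized g h η n x : ℝ)) *
        Complex.exp (ψ (x (Fin.last n))) := by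
    rw [sub_eq_neg_add, Complex.exp_add, Complex.exp_nat_mul, mul_assoc,
      ← pathSum_eigenvector W P g h hf n, pathSum, Finset.mul_sum]
    refine Finset.sum_congr rfl fun x _ => ?_
    rw [hX x, sub_eq_neg_add, Complex.exp_add]
    ring
  have hmgf : mgf (standardized g h η n) (pathLaw hW hP n).toMeasure z.re =
      ∑ x, ‖(pathProb W P n x : ℂ) * Complex.exp (z * (standardized g h η n x : ℝ))‖ := by
    rw [mgf, PMF.integral_eq_sum]
    refine Finset.sum_congr rfl fun x _ => ?_
    rw [pathLaw, PMF.ofFintype_apply, ENNReal.toReal_ofReal (pathProb_nonneg hW hP n x),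
      norm_mul, Complex.norm_of_nonneg (pathProb_nonneg hW hP n x), Complex.norm_exp]
    simp
  rw [hmain, hmgf, complexMGF_pathLaw, ← Finset.sum_sub_distrib, Finset.mul_sum]
  refine (norm_sum_le _ _).trans (Finset.sum_le_sum fun x _ => ?_)
  rw [← mul_one_sub, norm_mul, mul_comm]
  exact mul_le_mul_of_nonneg_right (Finset.single_le_sum
    (f := fun x => ‖1 - Complex.exp (ψ x)‖) (fun _ _ => norm_nonneg _) (Finset.mem_univ _))
    (norm_nonneg _)

/-- The error bound `ε m(Re z)` absorbs itself: at real arguments `G = m`, so `ε ≤ 1/2` bounds `m`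
by twice the main term, and the error then tends to zero at every complex argument. -/
theorem tendsto_of_norm_sub_le_mul {G : ℕ → ℂ → ℂ} {m : ℕ → ℝ → ℝ} {M : ℂ → ℕ → ℂ}
    {ε : ℂ → ℕ → ℝ} {l : ℂ → ℂ} (hG : ∀ n (r : ℝ), G n r = m n r) (hm : ∀ n r, 0 ≤ m n r)
    (hM : ∀ z, Tendsto (M z) atTop (𝓝 (l z))) (hε : ∀ z, Tendsto (ε z) atTop (𝓝 0))
    (h : ∀ z, ∀ᶠ n in atTop, ‖G n z - M z n‖ ≤ ε z n * m n z.re) (z : ℂ) :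
    Tendsto (fun n => G n z) atTop (𝓝 (l z)) := by
  have hbdd : ∀ r : ℝ, ∀ᶠ n in atTop, m n r ≤ 2 * (‖l r‖ + 1) := by
    intro r
    filter_upwards [h r, (hε r).eventually_le_const (show (0 : ℝ) < 1 / 2 by norm_num),
      (hM r).norm.eventually_le_const (lt_add_one ‖l r‖)] with n h1 h2 h3
    rw [hG, Complex.ofReal_re] at h1
    have h4 : m n r ≤ ‖M r n‖ + ‖(m n r : ℂ) - M r n‖ := by
      have := norm_add_le (M r n) ((m n r : ℂ) - M r n)
      rwa [add_sub_cancel, Complex.norm_of_nonneg (hm n r)] at this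
    nlinarith [mul_le_mul_of_nonneg_right h2 (hm n r)]
  have hz : Tendsto (fun n => G n z - M z n) atTop (𝓝 0) := by
    have h0 : Tendsto (fun n => |ε z n| * (2 * (‖l z.re‖ + 1))) atTop (𝓝 0) := by
      simpa using (hε z).abs.mul_const (2 * (‖l z.re‖ + 1))
    refine squeeze_zero_norm' ?_ h0
    filter_upwards [h z, hbdd z.re] with n h1 h2
    exact h1.trans (mul_le_mul (le_abs_self _) h2 (hm n _) (abs_nonneg _))
  simpa using hz.add (hM z)

/-- The moment generating functions of the standardized functional converge at every complex point.
Real points give the cumulant generating functions, imaginary ones the characteristic functions. -/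
theorem tendsto_complexMGF {S : Type*} [Fintype S] [DecidableEq S] [MeasurableSpace S]
    [DiscreteMeasurableSpace S] {W : Matrix S S ℝ} (hW : W ∈ Matrix.colStochastic ℝ S) {P : S → ℝ}
    (hP : P ∈ stdSimplex ℝ S) (g : S → S → ℝ) (h : S → ℝ) {ψ : S → ℂ → ℂ} {Λ : ℂ → ℂ} {η V : ℝ}
    (hψ : ∀ x, AnalyticAt ℂ (ψ x) 0) (hΛ : AnalyticAt ℂ Λ 0) (hψ0 : ∀ x, ψ x 0 = 0)
    (hΛ0 : Λ 0 = 0) (hη : (η : ℂ) = deriv Λ 0) (hV : (V : ℂ) = iteratedDeriv 2 Λ 0)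
    (heq : ∀ᶠ z in 𝓝 0, ∀ y,
        ∑ x, (W x y : ℂ) * Complex.exp (z * g x y + ψ x z - ψ y z - Λ z) = 1) (z : ℂ) :
    Tendsto (fun n => complexMGF (standardized g h η n) (pathLaw hW hP n).toMeasure z) atTop
      (𝓝 (Complex.exp (z ^ 2 * V / 2))) := by
  refine tendsto_of_norm_sub_le_mul
    (m := fun n => mgf (standardized g h η n) (pathLaw hW hP n).toMeasure)
    (M := fun z n => Complex.exp (n * Λ (z / ((√(n : ℝ) : ℝ) : ℂ)) - z * ((√(n : ℝ) : ℝ) : ℂ) * η) *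
      ∑ x, P x * Complex.exp (z / ((√(n : ℝ) : ℝ) : ℂ) * h x) *
        Complex.exp (ψ x (z / ((√(n : ℝ) : ℝ) : ℂ))))
    (ε := fun z n => ∑ x, ‖1 - Complex.exp (ψ x (z / ((√(n : ℝ) : ℝ) : ℂ)))‖)
    (l := fun z => Complex.exp (z ^ 2 * V / 2))
    (fun n r => complexMGF_ofReal r) (fun n r => mgf_nonneg) (fun z => ?_) (fun z => ?_)
    (fun z => ?_) z
  · have h1 := (tendsto_second_order hΛ hΛ0 z).cexp
    rw [← hη, ← hV] at h1
    have h2 : Tendsto (fun w : ℂ => ∑ x, P x * Complex.exp (w * h x) * Complex.exp (ψ x w))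
        (𝓝 0) (𝓝 1) := by
      have hc : ContinuousAt (fun w : ℂ => ∑ x, P x * Complex.exp (w * h x) * Complex.exp (ψ x w))
          0 := by
        have := fun x => (hψ x).continuousAt
        fun_prop
      have hP1 : ∑ x, (P x : ℂ) = 1 := by exact_mod_cast hP.2
      simpa [ContinuousAt, hψ0, hP1] using hc
    simpa using h1.mul (h2.comp (tendsto_div_sqrt z))
  · have h2 : Tendsto (fun w : ℂ => ∑ x, ‖1 - Complex.exp (ψ x w)‖) (𝓝 0) (𝓝 0) := by
      have hc : ContinuousAt (fun w : ℂ => ∑ x, ‖1 - Complex.exp (ψ x w)‖) 0 := by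
        have := fun x => (hψ x).continuousAt
        fun_prop
      simpa [ContinuousAt, hψ0] using hc
    exact h2.comp (tendsto_div_sqrt z)
  · filter_upwards [(tendsto_div_sqrt z).eventually heq, eventually_gt_atTop 0] with n h1 h2
    exact norm_complexMGF_sub_le hW hP g h η h2 z _ _ h1

/-! ### Convergence in distribution, of cumulants and of distribution functions -/

theorem gaussianReal_real_Iic {V : ℝ} (hV : 0 < V) (δ : ℝ) :
    (gaussianReal 0 V.toNNReal).real (Set.Iic δ) = stdNormalCDF (δ / √V) := by
  have hs : 0 < √V := Real.sqrt_pos.2 hV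
  have hmap : (gaussianReal 0 1).map (√V * ·) = gaussianReal 0 V.toNNReal := by
    rw [gaussianReal_map_const_mul]
    congr 1
    · simp
    · ext
      simp [Real.sq_sqrt hV.le, hV.le]
  have hpre : (√V * ·) ⁻¹' Set.Iic δ = Set.Iic (δ / √V) := by
    ext x
    simp [le_div_iff₀' hs]
  rw [← hmap, measureReal_def, Measure.map_apply (by fun_prop) measurableSet_Iic, hpre,
    gaussianReal_apply_eq_integral 0 one_ne_zero, ENNReal.toReal_ofReal
    (setIntegral_nonneg measurableSet_Iic fun x _ => gaussianPDFReal_nonneg 0 1 x), stdNormalCDF]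
  refine setIntegral_congr_fun measurableSet_Iic fun x _ => ?_
  simp [gaussianPDFReal, div_eq_inv_mul]

theorem measurable_standardized {S : Type*} [Fintype S] [MeasurableSpace S]
    [DiscreteMeasurableSpace S] (g : S → S → ℝ) (h : S → ℝ) (η : ℝ) (n : ℕ) :
    Measurable (standardized g h η n) := Measurable.of_discrete

theorem tendstoInDistribution_standardized {S : Type*} [Fintype S] [DecidableEq S]
    [MeasurableSpace S] [DiscreteMeasurableSpace S] {W : Matrix S S ℝ}
    (hW : W ∈ Matrix.colStochastic ℝ S) {P : S → ℝ} (hP : P ∈ stdSimplex ℝ S)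
    (g : S → S → ℝ) (h : S → ℝ) {η V : ℝ} (hV : 0 ≤ V)
    (hlim : ∀ z, Tendsto (fun n => complexMGF (standardized g h η n) (pathLaw hW hP n).toMeasure z)
      atTop (𝓝 (Complex.exp (z ^ 2 * V / 2)))) :
    TendstoInDistribution (standardized g h η) atTop (id : ℝ → ℝ)
      (fun n : ℕ => (pathLaw hW hP n).toMeasure) (gaussianReal 0 V.toNNReal) where
  forall_aemeasurable n := (measurable_standardized g h η n).aemeasurable
  tendsto := by
    refine ProbabilityMeasure.tendsto_iff_tendsto_charFun.2 fun t => ?_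
    have h1 := hlim (t * Complex.I)
    simp only [complexMGF_mul_I (measurable_standardized g h η _).aemeasurable] at h1
    have h2 : charFun (gaussianReal 0 V.toNNReal) t =
        Complex.exp ((t * Complex.I) ^ 2 * V / 2) := by
      rw [charFun_gaussianReal, Real.coe_toNNReal _ hV, mul_pow, Complex.I_sq]
      push_cast
      ring_nf
    simpa [h2] using h1

theorem tendsto_cgf_standardized {S : Type*} [Fintype S] [DecidableEq S] [MeasurableSpace S]
    [DiscreteMeasurableSpace S] {W : Matrix S S ℝ} (hW : W ∈ Matrix.colStochastic ℝ S) {P : S → ℝ}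
    (hP : P ∈ stdSimplex ℝ S) (g : S → S → ℝ) (h : S → ℝ) {η V : ℝ}
    (hlim : ∀ z, Tendsto (fun n => complexMGF (standardized g h η n) (pathLaw hW hP n).toMeasure z)
      atTop (𝓝 (Complex.exp (z ^ 2 * V / 2)))) (δ : ℝ) :
    Tendsto (fun n => cgf (standardized g h η n) (pathLaw hW hP n).toMeasure δ) atTop
      (𝓝 (δ ^ 2 * V / 2)) := by
  have h1 := (Complex.continuous_re.tendsto _).comp (hlim δ)
  have h2 : (Complex.exp ((δ : ℂ) ^ 2 * V / 2)).re = Real.exp (δ ^ 2 * V / 2) := by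
    rw [← Complex.ofReal_re (Real.exp _)]
    push_cast
    rfl
  rw [h2] at h1
  have h3 := h1.log (Real.exp_pos _).ne'
  rw [Real.log_exp] at h3
  exact h3.congr fun n => by simp [cgf, complexMGF_ofReal]

theorem tendsto_cdf_of_tendstoInDistribution {S : Type*} [Fintype S] [DecidableEq S]
    [MeasurableSpace S] [DiscreteMeasurableSpace S] {W : Matrix S S ℝ}
    (hW : W ∈ Matrix.colStochastic ℝ S) {P : S → ℝ} (hP : P ∈ stdSimplex ℝ S) (g : S → S → ℝ)
    (h : S → ℝ) {η V : ℝ} (hV : 0 < V)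
    (hlim : TendstoInDistribution (standardized g h η) atTop (id : ℝ → ℝ)
      (fun n : ℕ => (pathLaw hW hP n).toMeasure) (gaussianReal 0 V.toNNReal)) (δ : ℝ) :
    Tendsto (fun n : ℕ => (pathLaw hW hP n).toMeasure.real
          {x | additive g h n x - n * η ≤ √(n : ℝ) * δ})
        atTop (𝓝 (stdNormalCDF (δ / √V))) := by
  have hv : V.toNNReal ≠ 0 := (Real.toNNReal_pos.2 hV).ne'
  -- the limit has no atoms, so the half-line `(-∞, δ]` is a continuity set
  have := nullSingletonClass_gaussianReal (μ := 0) hv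
  have h1 := ProbabilityMeasure.tendsto_measure_of_null_frontier_of_tendsto' hlim.tendsto
    (E := Set.Iic δ) (by simp)
  simp only [ProbabilityMeasure.coe_mk, Measure.map_id] at h1
  have h2 := (ENNReal.tendsto_toReal (measure_ne_top _ _)).comp h1
  rw [← measureReal_def, gaussianReal_real_Iic hV] at h2
  refine h2.congr' ?_
  filter_upwards [eventually_gt_atTop 0] with n hn
  have hs : 0 < √(n : ℝ) := Real.sqrt_pos.2 (Nat.cast_pos.2 hn)
  have h3 : (n : ℝ) = √(n : ℝ) ^ 2 := (Real.sq_sqrt (Nat.cast_nonneg n)).symm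
  simp only [Function.comp_apply]
  rw [Measure.map_apply (measurable_standardized g h η n) measurableSet_Iic, measureReal_def]
  congr 2
  ext x
  have h4 : additive g h n x - n * η = √(n : ℝ) * standardized g h η n x := by
    have hn' : (n : ℝ) ≠ 0 := Nat.cast_ne_zero.2 hn.ne'
    rw [standardized, ← mul_assoc, Real.mul_self_sqrt (Nat.cast_nonneg n)]
    field_simp
  simp only [Set.mem_preimage, Set.mem_Iic, Set.mem_ofPred_eq, h4, mul_le_mul_iff_right₀ hs]

end MarkovCLT

end

theorem mainTheorem8 {S : Type*} [Fintype S] [DecidableEq S]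
    [MeasurableSpace S] [DiscreteMeasurableSpace S]
    (W : Matrix S S ℝ) (hW : W ∈ Matrix.colStochastic ℝ S) (hErg : MarkovCLT.IsErgodic W)
    (P : S → ℝ) (hP : P ∈ stdSimplex ℝ S) (g : S → S → ℝ) (h : S → ℝ)
    (η V : ℝ) (hη : η = deriv (MarkovCLT.potential W g) 0)
    (hV : V = iteratedDeriv 2 (MarkovCLT.potential W g) 0) :
    -- the two derivatives exist, and the second one is a variance
    ContDiffAt ℝ 2 (MarkovCLT.potential W g) 0 ∧ 0 ≤ V ∧
    -- convergence in distribution to the centred Gaussian of variance `V`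
    TendstoInDistribution
      (fun (n : ℕ) (x : Fin (n + 1) → S) => √(n : ℝ) * (MarkovCLT.additive g h n x / n - η))
      atTop (id : ℝ → ℝ) (fun n : ℕ => (MarkovCLT.pathLaw hW hP n).toMeasure)
      (gaussianReal 0 V.toNNReal) ∧
    -- convergence of the cumulant generating functions
    (∀ δ : ℝ, Tendsto
      (fun n : ℕ => cgf (fun x => √(n : ℝ) * (MarkovCLT.additive g h n x / n - η))
        (MarkovCLT.pathLaw hW hP n).toMeasure δ)
      atTop (𝓝 (δ ^ 2 * V / 2))) ∧
    -- the non-degenerate case: convergence of the distribution functions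
    ((¬ ∃ (f : S → ℝ) (c : ℝ), ∀ x y : S, 0 < W x y → g x y = f x - f y + c) →
      0 < V ∧ ∀ δ : ℝ, Tendsto
        (fun n : ℕ => (MarkovCLT.pathLaw hW hP n).toMeasure.real
          {x | MarkovCLT.additive g h n x - n * η ≤ √(n : ℝ) * δ})
        atTop (𝓝 (MarkovCLT.stdNormalCDF (δ / √V)))) := by
  have hirr := hErg.irreducible
  have : Nonempty S := by
    by_contra hS
    rw [not_nonempty_iff] at hS
    simpa using hP.2
  obtain ⟨ψ, Λ, u, hψ, hΛ, hψ0, hΛ0, heq, hpot, hu, hreal⟩ :=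
    MarkovCLT.exists_real_perron_branch hW hirr g
  obtain ⟨hcd, hη', hV'⟩ := MarkovCLT.contDiffAt_of_eq_ofReal hΛ hpot
  rw [← hη] at hη'
  rw [← hV] at hV'
  have hu0 : ∀ x, u x 0 = 0 := fun x => by
    simpa [hψ0] using (hu x).self_of_nhds.symm
  have hpot0 : MarkovCLT.potential W g 0 = 0 := by
    simpa [hΛ0] using hpot.self_of_nhds.symm
  have hsq := MarkovCLT.sum_sq_eq hW
    (fun x => (MarkovCLT.contDiffAt_of_eq_ofReal (hψ x) (hu x)).1) hcd hu0 hpot0 hreal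
  rw [← hη, ← hV] at hsq
  obtain ⟨hV0, hVz⟩ := MarkovCLT.nonneg_and_eq_zero_of_poisson_sq
    (a := fun x y => g x y + deriv (u x) 0 - deriv (u y) 0 - η) hW hirr hsq
  have hlim := MarkovCLT.tendsto_complexMGF hW hP g h hψ hΛ hψ0 hΛ0 hη' hV' heq
  have hdist := MarkovCLT.tendstoInDistribution_standardized hW hP g h hV0 hlim
  refine ⟨hcd, hV0, hdist, MarkovCLT.tendsto_cgf_standardized hW hP g h hlim, fun hg => ?_⟩
  have hVpos : 0 < V := by
    -- `k' = 0` at parameter `0` reads `g(x, y) = f(x) - f(y) + η` with `f = -u'(0)`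
    refine hV0.lt_of_ne fun h0 => hg ⟨fun x => -deriv (u x) 0, η, fun x y hxy => ?_⟩
    linarith [hVz h0.symm x y hxy]
  exact ⟨hVpos, MarkovCLT.tendsto_cdf_of_tendstoInDistribution hW hP g h hVpos hdist⟩
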